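/- Conventions. Manifolds are smooth (Hausdorff, second countable) of dimension $n+1\ge 2$. A *continuous* (resp. *smooth*) spacetime is such a manifold with a Lorentzian metric of signature $(-,+,\dots,+)$ whose components in all coordinates are continuous (resp. smooth), together with a time orientation given by a continuous timelike vector field. A *future directed causal curve* is a Lipschitz curve $\gamma\colon[a,b]\to M$, $a<b$, such that $\gamma'$ is (nonzero) future directed causal almost everywhere; it is *timelike* if in addition $g(\gamma',\gamma')<-\varepsilon$ almost everywhere for some $\varepsilon>0$. $I^+(x,M)$ is the set of endpoints $\gamma(b)$ of future directed timelike curves in $M$ with $\gamma(a)=x$. A continuous spacetime $(M_{\rm ext},g_{\rm ext})$ is a *continuous extension* of a smooth spacetime $(M,g)$ of the same dimension if there is a smooth isometric embedding $M\hookrightarrow M_{\rm ext}$ that preserves time orientations and whose image is a proper subset; $M$ is identified with its image. The *past boundary* $\partial^-M$ is the set of points $x\in\overline M\setminus M$ for which there is a future directed timelike curve $\gamma\colon[a,b]\to M_{\rm ext}$ with $\gamma(a)=x$ and $\gamma((a,b])\subset M$. A function on $M$ *extends continuously* to $M\cup\{\mathcal O\}$ if it is the restriction of a continuous function on the subspace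 $M\cup\{\mathcal O\}$ of $M_{\rm ext}$; a tensor on $M$ extends continuously to $M\cup\{\mathcal O\}$ if, in some coordinate neighborhood $U\subset M_{\rm ext}$ of $\mathcal O$, each of its components extends continuously from $U\cap M$ to $(U\cap M)\cup\{\mathcal O\}$. $(M_{\rm ext},g_{\rm ext})$ is *strongly causal at* $\mathcal O$ if for every neighborhood $U$ of $\mathcal O$ there is a neighborhood $V\subset U$ of $\mathcal O$ such that every future directed causal curve in $M_{\rm ext}$ with both endpoints in $V$ is contained in $U$. Theorem. Let $(M_{\rm ext},g_{\rm ext})$ be a continuous extension of a smooth spacetime $(M,g)$ of dimension $n+1\ge2$ such that $M=I^+(\mathcal O,M_{\rm ext})$ for some point $\mathcal O\in\partial^-M$. Assume: (a) $(M,g)$ solves the Einstein equations with a perfect fluid $(u,\rho,p)$: $u$ is a smooth future directed timelike vector field on $M$ with $g(u,u)=-1$, $\rho$ and $p$ are smooth functions on $M$, and $$\mathrm{Ric}-\tfrac12 R\,g=8\pi\big[(\rho+p)\,u_*\otimes u_*+p\,g\big],\qquad u_*=g(u,\cdot).$$ (b) All integral curves of $u$ have past endpoint $\mathcal O$ within $M_{\rm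 ext}$, and the extended curves are future directed timelike on compact domains. That is, every integral curve $(\alpha,b]\to M$ of $u$ continues to the past to an integral curve $\gamma\colon(a,b]\to M$ of $u$, with $a\le\alpha$ real, such that setting $\gamma(a)=\mathcal O$ makes $\gamma\colon[a,b]\to M_{\rm ext}$ a future directed timelike curve. (c) The Ricci tensor $\mathrm{Ric}$ of $(M,g)$, $\rho$ and $p$ extend continuously to $M\cup\{\mathcal O\}$. (d) $(M_{\rm ext},g_{\rm ext})$ is strongly causal at $\mathcal O$. Then the continuous extensions $\tilde\rho,\tilde p$ of $\rho,p$ satisfy $\tilde\rho(\mathcal O)=-\tilde p(\mathcal O)$. -/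

import Mathlib

open scoped Manifold ContDiff Topology
open Set MeasureTheory

noncomputable section

namespace Spacetimes

/-- The model space `ℝ^{n+1}` of `(n+1)`-dimensional manifolds; coordinates are
`x^0, …, x^n`. -/
abbrev Model (n : ℕ) : Type := EuclideanSpace ℝ (Fin (n + 1))

section Coordinates

variable {n : ℕ} {M : Type*} [TopologicalSpace M] [ChartedSpace (Model n) M]

/-- The coordinate vector `∂_i`, in the coordinates `e`, at the point with coordinates `y`. -/
def coordVec (e : OpenPartialHomeomorph M (Model n)) (y : Model n) (i : Fin (n + 1)) :
    TangentSpace (𝓡 (n + 1)) (e.symm y) :=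
  mfderiv (𝓡 (n + 1)) (𝓡 (n + 1)) e.symm y (EuclideanSpace.single i (1 : ℝ) : Model n)

/-- `dx^i(v)`: the `i`-th component of the tangent vector `v` in the coordinates `e`. -/
def coordForm (e : OpenPartialHomeomorph M (Model n)) (x : M)
    (v : TangentSpace (𝓡 (n + 1)) x) (i : Fin (n + 1)) : ℝ :=
  (show Model n from mfderiv (𝓡 (n + 1)) (𝓡 (n + 1)) e x v) i

/-- The matrix `g_{ij} = g(∂_i, ∂_j)` of a field of bilinear forms in the coordinates `e`, as a
function of the coordinates `y`. -/
def metricComp (g : ∀ x : M, LinearMap.BilinForm ℝ (TangentSpace (𝓡 (n + 1)) x))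
    (e : OpenPartialHomeomorph M (Model n)) (y : Model n) :
    Matrix (Fin (n + 1)) (Fin (n + 1)) ℝ :=
  Matrix.of fun i j => g (e.symm y) (coordVec e y i) (coordVec e y j)

/-- The partial derivative `∂f/∂x^k` on `ℝ^{n+1}`. -/
def partialDeriv (k : Fin (n + 1)) (f : Model n → ℝ) (y : Model n) : ℝ :=
  fderiv ℝ f y (EuclideanSpace.single k (1 : ℝ))

/-- The Christoffel symbols
`Γ^k_{ij} = ½ ∑_l g^{kl} (∂_i g_{jl} + ∂_j g_{il} - ∂_l g_{ij})` in the coordinates `e`. -/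
def christoffel (g : ∀ x : M, LinearMap.BilinForm ℝ (TangentSpace (𝓡 (n + 1)) x))
    (e : OpenPartialHomeomorph M (Model n)) (k i j : Fin (n + 1)) (y : Model n) : ℝ :=
  (1 / 2) * ∑ l, (metricComp g e y)⁻¹ k l *
    (partialDeriv i (fun z => metricComp g e z j l) y
      + partialDeriv j (fun z => metricComp g e z i l) y
      - partialDeriv l (fun z => metricComp g e z i j) y)

/-- The components of the Ricci tensor in the coordinates `e`:
`R_{ij} = ∂_k Γ^k_{ij} - ∂_j Γ^k_{ki} + Γ^k_{kl} Γ^l_{ij} - Γ^k_{jl} Γ^l_{ik}`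
(summation over `k` and `l`). -/
def ricciComp (g : ∀ x : M, LinearMap.BilinForm ℝ (TangentSpace (𝓡 (n + 1)) x))
    (e : OpenPartialHomeomorph M (Model n)) (y : Model n) :
    Matrix (Fin (n + 1)) (Fin (n + 1)) ℝ :=
  Matrix.of fun i j =>
    ∑ k, (partialDeriv k (christoffel g e k i j) y - partialDeriv j (christoffel g e k k i) y)
      + ∑ k, ∑ l, (christoffel g e k k l y * christoffel g e l i j y
          - christoffel g e k j l y * christoffel g e l i k y)

/-- The Ricci tensor `Ric = ∑ R_{ij} dx^i ⊗ dx^j` at `x`, computed in the preferred chart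
at `x` (for a smooth metric the result is the same in all charts). -/
def ricci (g : ∀ x : M, LinearMap.BilinForm ℝ (TangentSpace (𝓡 (n + 1)) x)) (x : M)
    (v w : TangentSpace (𝓡 (n + 1)) x) : ℝ :=
  ∑ i, ∑ j, ricciComp g (chartAt (Model n) x) (chartAt (Model n) x x) i j
    * coordForm (chartAt (Model n) x) x v i * coordForm (chartAt (Model n) x) x w j

/-- The scalar curvature `R = ∑ g^{ij} R_{ij}` at `x`. -/
def scalarCurvature (g : ∀ x : M, LinearMap.BilinForm ℝ (TangentSpace (𝓡 (n + 1)) x))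
    (x : M) : ℝ :=
  ∑ i, ∑ j, (metricComp g (chartAt (Model n) x) (chartAt (Model n) x x))⁻¹ i j
    * ricciComp g (chartAt (Model n) x) (chartAt (Model n) x x) i j

end Coordinates

/-- A symmetric bilinear form of signature `(-, +, …, +)`. -/
def IsLorentzian {n : ℕ} {V : Type*} [AddCommGroup V] [Module ℝ V]
    (B : LinearMap.BilinForm ℝ V) : Prop :=
  ∃ b : Module.Basis (Fin (n + 1)) ℝ V,
    ∀ i j, B (b i) (b j) = if i = j then (if i = 0 then -1 else 1) else 0

/-- A spacetime of dimension `n + 1` with a metric of class `C^k` (`k = 0`: continuous spacetime,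
`k = ∞`: smooth spacetime): a time-oriented Lorentzian metric on the smooth manifold `M`. The
regularity of the metric is that of its components in all coordinate systems; the
time orientation is given by a continuous timelike vector field. -/
structure Spacetime (n : ℕ) (k : WithTop ℕ∞) (M : Type*) [TopologicalSpace M]
    [ChartedSpace (Model n) M] [IsManifold (𝓡 (n + 1)) ∞ M] where
  /-- the metric -/
  metric : ∀ x : M, LinearMap.BilinForm ℝ (TangentSpace (𝓡 (n + 1)) x)
  isLorentzian : ∀ x, IsLorentzian (n := n) (metric x)
  contDiffOn : ∀ e ∈ IsManifold.maximalAtlas (𝓡 (n + 1)) ∞ M, ∀ i j,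
    ContDiffOn ℝ k (fun y => metricComp metric e y i j) e.target
  /-- the vector field that fixes the time orientation -/
  timeField : ∀ x : M, TangentSpace (𝓡 (n + 1)) x
  continuous_timeField :
    Continuous fun x => (⟨x, timeField x⟩ : TangentBundle (𝓡 (n + 1)) M)
  timelike_timeField : ∀ x, metric x (timeField x) (timeField x) < 0

section Causality

variable {n : ℕ} {k : WithTop ℕ∞} {M : Type*} [TopologicalSpace M] [ChartedSpace (Model n) M]
  [IsManifold (𝓡 (n + 1)) ∞ M]

/-- `v` is a future directed causal vector at `x`. -/
def Spacetime.IsFutureCausal (S : Spacetime n k M) (x : M)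
    (v : TangentSpace (𝓡 (n + 1)) x) : Prop :=
  v ≠ 0 ∧ S.metric x v v ≤ 0 ∧ S.metric x (S.timeField x) v < 0

/-- The velocity vector `γ'(t)`. -/
def velocity (γ : ℝ → M) (t : ℝ) : TangentSpace (𝓡 (n + 1)) (γ t) :=
  mfderiv 𝓘(ℝ, ℝ) (𝓡 (n + 1)) γ t (1 : ℝ)

/-- `γ : [a, b] → M` is a Lipschitz curve: it is continuous and, read in charts, Lipschitz near
each parameter value. By compactness of `[a, b]` this is the same as being Lipschitz for the
distance of any Riemannian metric on `M`. -/
def IsLipschitzCurve (n : ℕ) {M : Type*} [TopologicalSpace M] [ChartedSpace (Model n) M]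
    (γ : ℝ → M) (a b : ℝ) : Prop :=
  ContinuousOn γ (Icc a b) ∧
    ∀ t ∈ Icc a b, ∃ K : NNReal, ∃ s ∈ 𝓝[Icc a b] t,
      LipschitzOnWith K (fun τ => chartAt (Model n) (γ t) (γ τ)) s

/-- `γ : [a, b] → M` is a future directed causal curve. (The values of `γ` outside `[a, b]` are
irrelevant.) -/
def Spacetime.IsCausalCurve (S : Spacetime n k M) (γ : ℝ → M) (a b : ℝ) : Prop :=
  a < b ∧ IsLipschitzCurve n γ a b ∧
    ∀ᵐ t ∂(volume.restrict (Icc a b)),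
      MDifferentiableAt 𝓘(ℝ, ℝ) (𝓡 (n + 1)) γ t ∧ S.IsFutureCausal (γ t) (velocity γ t)

/-- `γ : [a, b] → M` is a future directed timelike curve: a Lipschitz curve that is future directed
timelike almost everywhere, with `g(γ', γ') < -ε` almost everywhere for some `ε > 0`. -/
def Spacetime.IsTimelikeCurve (S : Spacetime n k M) (γ : ℝ → M) (a b : ℝ) : Prop :=
  S.IsCausalCurve γ a b ∧
    ∃ ε > 0, ∀ᵐ t ∂(volume.restrict (Icc a b)),
      S.metric (γ t) (velocity γ t) (velocity γ t) < -ε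

/-- The timelike future `I^+(p, M)`. -/
def Spacetime.timelikeFuture (S : Spacetime n k M) (p : M) : Set M :=
  {q | ∃ (γ : ℝ → M) (a b : ℝ), S.IsTimelikeCurve γ a b ∧ γ a = p ∧ γ b = q}

/-- The past boundary `∂^- A` of `A` within `M`: points of `closure A \ A` from which a future
directed timelike curve starts that runs in `A` afterwards. -/
def Spacetime.pastBoundary (S : Spacetime n k M) (A : Set M) : Set M :=
  {p | p ∈ closure A \ A ∧ ∃ (γ : ℝ → M) (a b : ℝ),
    S.IsTimelikeCurve γ a b ∧ γ a = p ∧ ∀ t ∈ Ioc a b, γ t ∈ A}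

/-- Strong causality at the point `p`. -/
def Spacetime.IsStronglyCausalAt (S : Spacetime n k M) (p : M) : Prop :=
  ∀ U ∈ 𝓝 p, ∃ V ∈ 𝓝 p, V ⊆ U ∧ ∀ (γ : ℝ → M) (a b : ℝ),
    S.IsCausalCurve γ a b → γ a ∈ V → γ b ∈ V → ∀ t ∈ Icc a b, γ t ∈ U

/-- `(u, ρ, p)` is a perfect fluid on the smooth spacetime `S`, and `S` solves the Einstein
equations with it: `Ric - ½ R g = 8π ((ρ + p) u_* ⊗ u_* + p g)` with `u_* = g(u, ·)`. -/
structure Spacetime.SolvesEinsteinPerfectFluid (S : Spacetime n k M)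
    (u : ∀ x : M, TangentSpace (𝓡 (n + 1)) x) (ρ p : M → ℝ) : Prop where
  contMDiff_u : ContMDiff (𝓡 (n + 1)) (𝓡 (n + 1)).tangent ∞
    fun x => (⟨x, u x⟩ : TangentBundle (𝓡 (n + 1)) M)
  contMDiff_ρ : ContMDiff (𝓡 (n + 1)) 𝓘(ℝ, ℝ) ∞ ρ
  contMDiff_p : ContMDiff (𝓡 (n + 1)) 𝓘(ℝ, ℝ) ∞ p
  unit : ∀ x, S.metric x (u x) (u x) = -1
  future : ∀ x, S.IsFutureCausal x (u x)
  einstein : ∀ (x : M) (v w : TangentSpace (𝓡 (n + 1)) x),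
    ricci S.metric x v w - (1 / 2) * scalarCurvature S.metric x * S.metric x v w
      = 8 * Real.pi * ((ρ x + p x) * (S.metric x (u x) v * S.metric x (u x) w)
          + p x * S.metric x v w)

end Causality

section Extension

variable {n : ℕ} {M N : Type*} [TopologicalSpace M] [ChartedSpace (Model n) M]
  [IsManifold (𝓡 (n + 1)) ∞ M]
  [TopologicalSpace N] [ChartedSpace (Model n) N] [IsManifold (𝓡 (n + 1)) ∞ N]

/-- The continuous spacetime `S'` on `N` is a continuous extension of the smooth spacetime `S` on
`M`, of the same dimension, through the isometric embedding `ι`. -/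
structure IsContinuousExtension (S : Spacetime n ∞ M) (S' : Spacetime n 0 N) (ι : M → N) :
    Prop where
  isSmoothEmbedding : Manifold.IsSmoothEmbedding (𝓡 (n + 1)) (𝓡 (n + 1)) ∞ ι
  isometric : ∀ (x : M) (v w : TangentSpace (𝓡 (n + 1)) x),
    S'.metric (ι x) (mfderiv (𝓡 (n + 1)) (𝓡 (n + 1)) ι x v)
      (mfderiv (𝓡 (n + 1)) (𝓡 (n + 1)) ι x w) = S.metric x v w
  timeOrientation : ∀ (x : M) (v : TangentSpace (𝓡 (n + 1)) x),
    S.IsFutureCausal x v →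
      S'.IsFutureCausal (ι x) (mfderiv (𝓡 (n + 1)) (𝓡 (n + 1)) ι x v)
  proper : range ι ≠ univ

/-- `f'` is a continuous extension of the function `f` on `M` to `M ∪ {O}`, with the topology of
the subspace `M ∪ {O}` of `N`; values of `f'` elsewhere are irrelevant. -/
def IsContinuousExtensionOf (ι : M → N) (O : N) (f : M → ℝ) (f' : N → ℝ) : Prop :=
  ContinuousOn f' (range ι ∪ {O}) ∧ ∀ x, f' (ι x) = f x

/-- A tensor `T` of type `(0,2)` on `M` extends continuously to `M ∪ {O}`: in some coordinate
system `e` of `N` around `O`, with domain `U`, the components `T_{ij}` in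
`T = ∑ T_{ij} dx^i ⊗ dx^j` on `U ∩ M` extend to continuous functions on `(U ∩ M) ∪ {O}`. -/
def TensorExtendsContinuously (ι : M → N) (O : N)
    (T : ∀ x : M, TangentSpace (𝓡 (n + 1)) x → TangentSpace (𝓡 (n + 1)) x → ℝ) : Prop :=
  ∃ e ∈ IsManifold.maximalAtlas (𝓡 (n + 1)) ∞ N, O ∈ e.source ∧
    ∃ F : Fin (n + 1) → Fin (n + 1) → N → ℝ,
      (∀ i j, ContinuousOn (F i j) ((e.source ∩ range ι) ∪ {O})) ∧
      ∀ x : M, ι x ∈ e.source → ∀ v w : TangentSpace (𝓡 (n + 1)) x,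
        T x v w = ∑ i, ∑ j, F i j (ι x)
          * coordForm e (ι x) (mfderiv (𝓡 (n + 1)) (𝓡 (n + 1)) ι x v) i
          * coordForm e (ι x) (mfderiv (𝓡 (n + 1)) (𝓡 (n + 1)) ι x w) j

/-- All integral curves of `u` have past endpoint `O` within `N`, and the extended curves are future
directed timelike on compact domains: every integral curve `c : (α, b] → M` of `u` continues to
the past to an integral curve `d : (a, b] → M` such that the curve `[a, b] → N` that
starts at `O` and follows `ι ∘ d` on `(a, b]` is (continuous and) future directed timelike. -/
def IntegralCurvesHavePastEndpoint (S' : Spacetime n 0 N) (ι : M → N)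
    (u : ∀ x : M, TangentSpace (𝓡 (n + 1)) x) (O : N) : Prop :=
  ∀ (c : ℝ → M) (α b : ℝ), α < b → IsMIntegralCurveOn c u (Ioc α b) →
    ∃ (d : ℝ → M) (a : ℝ), a ≤ α ∧ EqOn d c (Ioc α b) ∧ IsMIntegralCurveOn d u (Ioc a b) ∧
      ∃ γ : ℝ → N, γ a = O ∧ (∀ t ∈ Ioc a b, γ t = ι (d t)) ∧ S'.IsTimelikeCurve γ a b

end Extension

end Spacetimes

end

/-! Suppose `ρ + p` does not vanish at `O`. The Einstein equations read `Ric = c g + μ u_* ⊗ u_*`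
with `μ = 8π(ρ + p)`. Nothing is known about `c` near `O`, since it contains the scalar curvature,
but taking the trace and using `g(u, u) = -1` expresses `c` through `g`, `Ric` and `μ`. Solving for
`u ⊗ u` (`vecMulVec_eq_of_perfectFluid`) writes it as a continuous function of quantities that
converge at `O`. The limit is nonzero, again by `g(u, u) = -1`, so the direction of `u` converges to
that of some `r` (`exists_tendsto_fluid_direction`).

This contradicts the fluid lines filling a whole timelike cone at `O`. Every point of `M` lies on a
fluid line issuing from `O`, and by strong causality such a line stays near `O` if its other
endpoint is near enough. By Cauchy's mean value theorem, two chosen components of its coordinate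
chord are then proportional to those of `u` at some point near `O`
(`exists_ratio_of_integralCurve`), hence almost to those of `r`. But `M = I⁺(O)` contains points
arbitrarily close to `O` on any short timelike coordinate line from `O`, and in dimension at least
two such a line can be chosen in a direction `w` not parallel to `r` (`exists_timelike_direction`).
-/

noncomputable section

namespace Spacetimes

open Matrix Filter

/-! ### Linear algebra: recovering the fluid direction from the Einstein equations. -/

section LinearAlgebra

/-- If `F = c A + μ a ⊗ a` with `a = A(u, ·)` and `A(u, u) = -1`, then `u ⊗ u` is determined by
`A`, `F` and `μ`. -/
theorem vecMulVec_eq_of_perfectFluid {κ : Type*} [Fintype κ] [DecidableEq κ] [Nonempty κ]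
    {A F : Matrix κ κ ℝ} {u : κ → ℝ} {c μ : ℝ} (hA : IsUnit A.det) (hμ : μ ≠ 0)
    (hu : (u ᵥ* A) ⬝ᵥ u = -1)
    (hF : F = c • A + μ • vecMulVec (u ᵥ* A) (u ᵥ* A)) :
    vecMulVec u u =
      μ⁻¹ • (A⁻¹ᵀ * F * A⁻¹ - (((A⁻¹ * F).trace + μ) / Fintype.card κ) • A⁻¹ᵀ) := by
  have hcard : (Fintype.card κ : ℝ) ≠ 0 := by simp
  have hua : (u ᵥ* A) ᵥ* A⁻¹ = u := by
    rw [Matrix.vecMul_vecMul, Matrix.mul_nonsing_inv _ hA, Matrix.vecMul_one]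
  -- The trace of `a ⊗ a` against `A⁻¹` is `A(u, u) = -1`, so the trace of `F` determines `c`.
  have htr : (A⁻¹ * F).trace = Fintype.card κ * c - μ := by
    rw [hF, Matrix.mul_add, Matrix.mul_smul, Matrix.mul_smul, Matrix.nonsing_inv_mul _ hA,
      Matrix.trace_add, Matrix.trace_smul, Matrix.trace_smul, Matrix.trace_one,
      Matrix.mul_vecMulVec, Matrix.trace_vecMulVec, dotProduct_comm, Matrix.dotProduct_mulVec,
      hua, dotProduct_comm, hu]
    simp; ring
  have hcoef : ((A⁻¹ * F).trace + μ) / Fintype.card κ = c := by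
    rw [htr]; field_simp; ring
  -- Raising both indices turns `a ⊗ a` into `u ⊗ u`. The transposes make this work without symmetry
  -- of `A`.
  have h1 : A⁻¹ᵀ * F * A⁻¹ = c • A⁻¹ᵀ + μ • vecMulVec u u := by
    rw [hF, Matrix.mul_add, Matrix.add_mul, Matrix.mul_smul, Matrix.mul_smul, Matrix.smul_mul,
      Matrix.smul_mul, Matrix.mul_assoc, Matrix.mul_nonsing_inv _ hA, Matrix.mul_one,
      Matrix.mul_vecMulVec, Matrix.vecMulVec_mul, hua, Matrix.mulVec_transpose, hua]
  rw [hcoef, h1, add_sub_cancel_left, smul_smul, inv_mul_cancel₀ hμ, one_smul]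

/-- If the products `u_i u_j` converge, not all to zero, then the direction of `u` converges. -/
theorem exists_tendsto_ratio {X κ : Type*} {l : Filter X} {u : X → κ → ℝ} {W : κ → κ → ℝ}
    (hW : ∀ i j, Tendsto (fun x => u x i * u x j) l (𝓝 (W i j))) (hl : l.NeBot)
    (hne : ∃ i j, W i j ≠ 0) :
    ∃ i₀, (∀ᶠ x in l, u x i₀ ≠ 0) ∧
      ∀ j, Tendsto (fun x => u x j / u x i₀) l (𝓝 (W j i₀ / W i₀ i₀)) := by
  obtain ⟨i, j, hij⟩ := hne
  -- The identity `(u_i u_j)² = u_i² u_j²` passes to the limit, so `W i i = 0` would force `W i j =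
  -- 0`.
  have key : W i i ≠ 0 := by
    intro h0
    have h1 := (hW i j).mul (hW i j)
    have h2 := (hW i i).mul (hW j j)
    have h3 : (fun x => u x i * u x j * (u x i * u x j))
        = fun x => u x i * u x i * (u x j * u x j) := by
      funext x; ring
    rw [h3] at h1
    have h4 := tendsto_nhds_unique h1 h2
    rw [h0, zero_mul] at h4
    exact hij (mul_self_eq_zero.1 h4)
  have hev : ∀ᶠ x in l, u x i ≠ 0 := by
    filter_upwards [(hW i i).eventually_ne key] with x hx h
    simp [h] at hx
  refine ⟨i, hev, fun k => ((hW k i).div (hW i i) key).congr' ?_⟩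
  filter_upwards [hev] with x hx
  exact mul_div_mul_right _ _ hx

theorem tendsto_vecMul_dotProduct {X κ : Type*} [Fintype κ] {l : Filter X}
    {v w : X → κ → ℝ} {A : X → Matrix κ κ ℝ} {v₀ w₀ : κ → ℝ} {A₀ : Matrix κ κ ℝ}
    (hv : Tendsto v l (𝓝 v₀)) (hA : Tendsto A l (𝓝 A₀)) (hw : Tendsto w l (𝓝 w₀)) :
    Tendsto (fun x => (v x ᵥ* A x) ⬝ᵥ w x) l (𝓝 ((v₀ ᵥ* A₀) ⬝ᵥ w₀)) := by
  have hA' : ∀ i j, Tendsto (fun x => A x i j) l (𝓝 (A₀ i j)) := fun i j =>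
    tendsto_pi_nhds.1 (tendsto_pi_nhds.1 hA i) j
  exact tendsto_finsetSum _ fun j _ => (tendsto_finsetSum _ fun i _ =>
    (tendsto_pi_nhds.1 hv i).mul (hA' i j)).mul (tendsto_pi_nhds.1 hw j)

theorem IsLorentzian.eq_zero_of_forall {n : ℕ} {V : Type*} [AddCommGroup V] [Module ℝ V]
    {B : LinearMap.BilinForm ℝ V} (hB : IsLorentzian (n := n) B) {v : V}
    (hv : ∀ w, B w v = 0) : v = 0 := by
  obtain ⟨b, hb⟩ := hB
  rw [← b.sum_repr v] at hv ⊢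
  refine Finset.sum_eq_zero fun i _ => ?_
  have h := hv (b i)
  simp only [map_sum, map_smul, hb, smul_eq_mul] at h
  rw [Finset.sum_eq_single i (fun j _ hj => by simp [hj.symm]) (by simp)] at h
  by_cases hi : i = 0
  · simp [hi] at h; simp [hi, h]
  · simp [hi] at h; simp [h]

end LinearAlgebra

/-! ### Tangent vectors, metric and time field in a chart. -/

section Coordinates

variable {n : ℕ} {N : Type*} [TopologicalSpace N] [ChartedSpace (Model n) N]
  {e : OpenPartialHomeomorph N (Model n)}

theorem mdifferentiable_of_mem_maximalAtlas_infty
    (he : e ∈ IsManifold.maximalAtlas (𝓡 (n + 1)) ∞ N) :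
    e.MDifferentiable (𝓡 (n + 1)) (𝓡 (n + 1)) :=
  ⟨(contMDiffOn_of_mem_maximalAtlas he).mdifferentiableOn (by simp),
    (contMDiffOn_symm_of_mem_maximalAtlas he).mdifferentiableOn (by simp)⟩

theorem exists_coordForm_eq (he : e ∈ IsManifold.maximalAtlas (𝓡 (n + 1)) ∞ N) {z : N}
    (hz : z ∈ e.source) (ξ : Fin (n + 1) → ℝ) :
    ∃ v : TangentSpace (𝓡 (n + 1)) z, coordForm e z v = ξ := by
  obtain ⟨v, hv⟩ := (mdifferentiable_of_mem_maximalAtlas_infty he).mfderiv_surjective hz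
    (WithLp.toLp 2 ξ : Model n)
  refine ⟨v, ?_⟩
  funext i
  unfold coordForm
  rw [hv]

theorem sum_coordForm_smul_coordVec (he : e ∈ IsManifold.maximalAtlas (𝓡 (n + 1)) ∞ N)
    {y : Model n} (hy : y ∈ e.target) (v : TangentSpace (𝓡 (n + 1)) (e.symm y)) :
    v = ∑ i, coordForm e (e.symm y) v i • coordVec e y i := by
  let E : TangentSpace (𝓡 (n + 1)) (e.symm y) →L[ℝ] Model n :=
    mfderiv (𝓡 (n + 1)) (𝓡 (n + 1)) e (e.symm y)
  let E' : Model n →L[ℝ] TangentSpace (𝓡 (n + 1)) (e.symm y) :=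
    mfderiv (𝓡 (n + 1)) (𝓡 (n + 1)) e.symm y
  have hEE : E'.comp E = ContinuousLinearMap.id _ _ := by
    have h := (mdifferentiable_of_mem_maximalAtlas_infty he).symm_comp_deriv (e.map_target hy)
    rwa [e.right_inv hy] at h
  have h1 : E' (E v) = v := DFunLike.congr_fun hEE v
  have h2 : E v = ∑ i, E v i • EuclideanSpace.single i (1 : ℝ) := by
    conv_lhs => rw [← (EuclideanSpace.basisFun (Fin (n + 1)) ℝ).sum_repr (E v)]
    simp
  calc v = E' (E v) := h1.symm
    _ = E' (∑ i, E v i • EuclideanSpace.single i (1 : ℝ)) := by rw [← h2]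
    _ = ∑ i, E v i • E' (EuclideanSpace.single i (1 : ℝ)) := by simp only [map_sum, map_smul]

/-- The metric in coordinates. -/
theorem metric_eq_dotProduct (he : e ∈ IsManifold.maximalAtlas (𝓡 (n + 1)) ∞ N)
    (g : ∀ x : N, LinearMap.BilinForm ℝ (TangentSpace (𝓡 (n + 1)) x)) {z : N} (hz : z ∈ e.source)
    (v w : TangentSpace (𝓡 (n + 1)) z) :
    g z v w = (coordForm e z v ᵥ* metricComp g e (e z)) ⬝ᵥ coordForm e z w := by
  obtain ⟨y, hy, rfl⟩ : ∃ y ∈ e.target, e.symm y = z := ⟨e z, e.map_source hz, e.left_inv hz⟩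
  rw [e.right_inv hy]
  conv_lhs => rw [sum_coordForm_smul_coordVec he hy v, sum_coordForm_smul_coordVec he hy w]
  simp only [map_sum, map_smul, LinearMap.sum_apply, LinearMap.smul_apply, smul_eq_mul,
    dotProduct, vecMul, metricComp, Matrix.of_apply, Finset.sum_mul]
  refine Finset.sum_congr rfl fun i _ => ?_
  rw [Finset.mul_sum]
  refine Finset.sum_congr rfl fun j _ => ?_
  ring

variable [IsManifold (𝓡 (n + 1)) ∞ N]

/-- A kernel vector of the matrix would consist of the components of a tangent vector orthogonal to
everything, and the metric is nondegenerate. -/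
theorem isUnit_det_metricComp {k : WithTop ℕ∞} (S : Spacetime n k N)
    (he : e ∈ IsManifold.maximalAtlas (𝓡 (n + 1)) ∞ N) {z : N} (hz : z ∈ e.source) :
    IsUnit (metricComp S.metric e (e z)).det := by
  rw [isUnit_iff_ne_zero]
  intro h
  obtain ⟨ξ, hξ, h0⟩ := Matrix.exists_mulVec_eq_zero_iff.2 h
  obtain ⟨v, rfl⟩ := exists_coordForm_eq he hz ξ
  apply hξ
  have hv : v = 0 := (S.isLorentzian z).eq_zero_of_forall fun w => by
    rw [metric_eq_dotProduct he S.metric hz, ← Matrix.dotProduct_mulVec, h0, dotProduct_zero]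
  funext i
  simp only [hv, coordForm, map_zero]
  rfl

theorem continuousAt_metricComp {k : WithTop ℕ∞} (S : Spacetime n k N)
    (he : e ∈ IsManifold.maximalAtlas (𝓡 (n + 1)) ∞ N) {y : Model n} (hy : y ∈ e.target) :
    ContinuousAt (metricComp S.metric e) y := by
  refine continuousAt_pi.2 fun i => continuousAt_pi.2 fun j => ?_
  exact (S.contDiffOn e he i j).continuousOn.continuousAt (e.open_target.mem_nhds hy)

/-- The time field is continuous as a section of the tangent bundle; the tangent map of the chart
carries it to the trivial bundle over the model space, where components can be read off. -/
theorem continuousAt_coordForm_timeField {k : WithTop ℕ∞} (S : Spacetime n k N)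
    (he : e ∈ IsManifold.maximalAtlas (𝓡 (n + 1)) ∞ N) {z : N} (hz : z ∈ e.source) :
    ContinuousAt (fun x => coordForm e x (S.timeField x)) z := by
  have h1 := (contMDiffOn_of_mem_maximalAtlas he).continuousOn_tangentMapWithin (by simp)
    e.open_source.uniqueMDiffOn
  have h2 : ContinuousOn (fun x => tangentMapWithin (𝓡 (n + 1)) (𝓡 (n + 1)) e e.source
      ⟨x, S.timeField x⟩) e.source :=
    h1.comp S.continuous_timeField.continuousOn fun x hx => hx
  have h3 := (tangentBundleModelSpaceHomeomorph (𝓡 (n + 1))).continuous.comp_continuousOn h2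
  have h5 : ContinuousOn (fun x => coordForm e x (S.timeField x)) e.source := by
    refine continuousOn_pi.2 fun i => ?_
    refine ((EuclideanSpace.proj (𝕜 := ℝ) i).continuous.comp_continuousOn
      (continuous_snd.comp_continuousOn h3)).congr fun x hx => ?_
    simp only [coordForm, ← mfderivWithin_of_isOpen e.open_source hx]
    rfl
  exact h5.continuousAt (e.open_source.mem_nhds hz)

end Coordinates

/-! ### Straight coordinate lines as timelike curves. -/

section CoordinateLines

variable {n : ℕ} {N : Type*} [TopologicalSpace N] [ChartedSpace (Model n) N]
  {e : OpenPartialHomeomorph N (Model n)}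

/-- The line `t ↦ y₀ + t w` in the coordinates `e`. -/
def coordLine (e : OpenPartialHomeomorph N (Model n)) (y₀ w : Model n) (t : ℝ) : N :=
  e.symm (y₀ + t • w)

theorem contMDiffAt_coordLine (he : e ∈ IsManifold.maximalAtlas (𝓡 (n + 1)) ∞ N)
    {y₀ w : Model n} {t : ℝ} (ht : y₀ + t • w ∈ e.target) :
    ContMDiffAt 𝓘(ℝ, ℝ) (𝓡 (n + 1)) ∞ (coordLine e y₀ w) t := by
  have h1 : ContMDiffAt 𝓘(ℝ, ℝ) (𝓡 (n + 1)) ∞ (fun t : ℝ => y₀ + t • w) t :=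
    ContDiffAt.contMDiffAt (by fun_prop)
  exact (contMDiffAt_symm_of_mem_maximalAtlas he ht).comp t h1

theorem coordForm_velocity_coordLine (he : e ∈ IsManifold.maximalAtlas (𝓡 (n + 1)) ∞ N)
    {y₀ w : Model n} {t : ℝ} (ht : y₀ + t • w ∈ e.target) :
    coordForm e (coordLine e y₀ w t) (velocity (n := n) (coordLine e y₀ w) t) = w := by
  have hd := mdifferentiable_of_mem_maximalAtlas_infty he
  have hγ : MDifferentiableAt 𝓘(ℝ, ℝ) (𝓡 (n + 1)) (coordLine e y₀ w) t :=
    (contMDiffAt_coordLine he ht).mdifferentiableAt (by simp)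
  have hsrc : coordLine e y₀ w t ∈ e.source := e.map_target ht
  have hcomp := mfderiv_comp t (hd.mdifferentiableAt hsrc) hγ
  have hcont : ContinuousAt (fun t : ℝ => y₀ + t • w) t := by fun_prop
  have hev : (e ∘ coordLine e y₀ w) =ᶠ[𝓝 t] fun t : ℝ => y₀ + t • w := by
    filter_upwards [hcont.preimage_mem_nhds (e.open_target.mem_nhds ht)] with s hs
    exact e.right_inv hs
  have hder : HasDerivAt (fun t : ℝ => y₀ + t • w) w t := by
    simpa using ((hasDerivAt_id t).smul_const w).const_add y₀
  have hm : mfderiv 𝓘(ℝ, ℝ) (𝓡 (n + 1)) (e ∘ coordLine e y₀ w) t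
      = ContinuousLinearMap.toSpanSingleton ℝ w := by
    rw [hev.mfderiv_eq, mfderiv_eq_fderiv]
    exact hder.hasFDerivAt.fderiv
  rw [hm] at hcomp
  have h1 : w = mfderiv (𝓡 (n + 1)) (𝓡 (n + 1)) e (coordLine e y₀ w t)
      (mfderiv 𝓘(ℝ, ℝ) (𝓡 (n + 1)) (coordLine e y₀ w) t (1 : ℝ)) := by
    have := DFunLike.congr_fun hcomp (1 : ℝ)
    refine Eq.trans ?_ this
    exact (one_smul ℝ w).symm
  funext i
  exact congrArg (fun z : Model n => z i) h1.symm

variable [IsManifold (𝓡 (n + 1)) ∞ N]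

/-- The Lipschitz condition refers to the preferred charts, in which the line need not be straight;
it is still `C¹` there, hence locally Lipschitz. -/
theorem isLipschitzCurve_coordLine (he : e ∈ IsManifold.maximalAtlas (𝓡 (n + 1)) ∞ N)
    {y₀ w : Model n} {a b : ℝ} (h : ∀ t ∈ Icc a b, y₀ + t • w ∈ e.target) :
    IsLipschitzCurve n (coordLine e y₀ w) a b := by
  refine ⟨fun t ht => (contMDiffAt_coordLine he (h t ht)).continuousAt.continuousWithinAt,
    fun t ht => ?_⟩
  have h1 : ContMDiffAt 𝓘(ℝ, ℝ) (𝓡 (n + 1)) ∞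
      (fun τ => chartAt (Model n) (coordLine e y₀ w t) (coordLine e y₀ w τ)) t :=
    (contMDiffAt_of_mem_maximalAtlas (IsManifold.chart_mem_maximalAtlas _)
      (mem_chart_source _ _)).comp t (contMDiffAt_coordLine he (h t ht))
  obtain ⟨K, s, hs, hK⟩ := (h1.contDiffAt.of_le (by simp) :
    ContDiffAt ℝ 1 _ t).exists_lipschitzOnWith
  exact ⟨K, s, mem_nhdsWithin_of_mem_nhds hs, hK⟩

/-- Short coordinate lines in a future directed timelike direction are timelike curves. -/
theorem eventually_isTimelikeCurve_coordLine {k : WithTop ℕ∞} (S : Spacetime n k N)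
    (he : e ∈ IsManifold.maximalAtlas (𝓡 (n + 1)) ∞ N) {x : N} (hx : x ∈ e.source) {w : Model n}
    (hw : (w ᵥ* metricComp S.metric e (e x)) ⬝ᵥ w < 0)
    (hT : (coordForm e x (S.timeField x) ᵥ* metricComp S.metric e (e x)) ⬝ᵥ w < 0) :
    ∀ᶠ s in 𝓝[>] (0 : ℝ), S.IsTimelikeCurve (coordLine e (e x) w) 0 s := by
  have hc : ContinuousAt (fun t : ℝ => e x + t • w) 0 := by fun_prop
  have h0 : e x + (0 : ℝ) • w = e x := by simp
  have hx' := e.map_source hx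
  have ht : ∀ᶠ t in 𝓝 (0 : ℝ), e x + t • w ∈ e.target :=
    hc.eventually (by simpa only [h0] using e.open_target.eventually_mem hx')
  have hA : ContinuousAt (fun t : ℝ => metricComp S.metric e (e x + t • w)) 0 :=
    ContinuousAt.comp (g := metricComp S.metric e)
      (by rw [h0]; exact continuousAt_metricComp S he hx') hc
  have hl0 : coordLine e (e x) w 0 = x := by simp [coordLine, e.left_inv hx]
  have hl : ContinuousAt (coordLine e (e x) w) 0 :=
    (contMDiffAt_coordLine he (by simpa using hx')).continuousAt
  have hTc : ContinuousAt (fun t : ℝ => coordForm e (coordLine e (e x) w t)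
      (S.timeField (coordLine e (e x) w t))) 0 :=
    ContinuousAt.comp (g := fun x => coordForm e x (S.timeField x))
      (by rw [hl0]; exact continuousAt_coordForm_timeField S he hx) hl
  set q := (w ᵥ* metricComp S.metric e (e x)) ⬝ᵥ w with hq
  -- The bound `q / 2` stays a fixed distance below zero, which yields the uniform `ε = -(q / 2)` of
  -- a timelike curve.
  have h1 : ∀ᶠ t in 𝓝 (0 : ℝ),
      (w ᵥ* metricComp S.metric e (e x + t • w)) ⬝ᵥ w < q / 2 := by
    refine (tendsto_vecMul_dotProduct tendsto_const_nhds hA tendsto_const_nhds).eventually_lt_const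
      ?_
    beta_reduce
    rw [h0, ← hq]; linarith
  have h2 : ∀ᶠ t in 𝓝 (0 : ℝ), (coordForm e (coordLine e (e x) w t)
      (S.timeField (coordLine e (e x) w t)) ᵥ* metricComp S.metric e (e x + t • w)) ⬝ᵥ w < 0 := by
    refine (tendsto_vecMul_dotProduct hTc hA tendsto_const_nhds).eventually_lt_const ?_
    beta_reduce
    rw [h0, hl0]; exact hT
  obtain ⟨δ, hδ, hball⟩ := Metric.eventually_nhds_iff_ball.1 (ht.and (h1.and h2))
  filter_upwards [Ioo_mem_nhdsGT hδ] with s hs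
  have hIcc : ∀ t ∈ Icc (0 : ℝ) s, t ∈ Metric.ball (0 : ℝ) δ := fun t ht => by
    rw [Metric.mem_ball, Real.dist_eq, sub_zero, abs_of_nonneg ht.1]
    exact ht.2.trans_lt hs.2
  have hmet : ∀ t ∈ Icc (0 : ℝ) s, S.metric (coordLine e (e x) w t)
      (velocity (n := n) (coordLine e (e x) w) t) (velocity (n := n) (coordLine e (e x) w) t)
        < q / 2 := fun t ht => by
    obtain ⟨a1, a2, a3⟩ := hball t (hIcc t ht)
    rw [metric_eq_dotProduct he S.metric (show coordLine e (e x) w t ∈ e.source from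
        e.map_target a1), coordForm_velocity_coordLine he a1,
      coordLine, e.right_inv a1]
    exact a2
  refine ⟨⟨hs.1, isLipschitzCurve_coordLine he fun t ht => (hball t (hIcc t ht)).1, ?_⟩,
    -(q / 2), by linarith, ?_⟩
  · refine (ae_restrict_iff' measurableSet_Icc).2 (Eventually.of_forall fun t ht => ?_)
    obtain ⟨a1, a2, a3⟩ := hball t (hIcc t ht)
    refine ⟨(contMDiffAt_coordLine he a1).mdifferentiableAt (by simp), ?_, ?_, ?_⟩
    · intro h
      have := hmet t ht
      rw [h] at this
      simp at this
      linarith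
    · have := hmet t ht
      linarith
    · rw [metric_eq_dotProduct he S.metric (show coordLine e (e x) w t ∈ e.source from
        e.map_target a1), coordForm_velocity_coordLine he a1,
        coordLine, e.right_inv a1]
      exact a3
  · refine (ae_restrict_iff' measurableSet_Icc).2 (Eventually.of_forall fun t ht => ?_)
    rw [neg_neg]
    exact hmet t ht

/-- In dimension at least two, there are future directed timelike directions off any given line. -/
theorem exists_timelike_direction (hn : 1 ≤ n) {k : WithTop ℕ∞} (S : Spacetime n k N)
    (he : e ∈ IsManifold.maximalAtlas (𝓡 (n + 1)) ∞ N) {x : N} (hx : x ∈ e.source)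
    (i₀ : Fin (n + 1)) (r : Fin (n + 1) → ℝ) :
    ∃ w : Model n, (w ᵥ* metricComp S.metric e (e x)) ⬝ᵥ w < 0 ∧
      (coordForm e x (S.timeField x) ᵥ* metricComp S.metric e (e x)) ⬝ᵥ w < 0 ∧
      ∃ j, w j ≠ w i₀ * r j := by
  set A := metricComp S.metric e (e x)
  set T := coordForm e x (S.timeField x)
  have hTT : (T ᵥ* A) ⬝ᵥ T < 0 := by
    rw [← metric_eq_dotProduct he S.metric hx]; exact S.timelike_timeField x
  have : Nontrivial (Fin (n + 1)) := Fin.nontrivial_iff_two_le.2 (by omega)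
  obtain ⟨j, hj⟩ := exists_ne i₀
  -- Moving the time vector along `∂_j` with `j ≠ i₀` changes its `j`-th component and keeps the
  -- `i₀`-th. Small `η` preserve the two open conditions, and at most one `η` satisfies the
  -- forbidden proportionality, so one of `0` and `δ / 2` works.
  let c : ℝ → Fin (n + 1) → ℝ := fun η => T + η • Pi.single j 1
  have hc : Continuous c := by fun_prop
  have h1 : ∀ᶠ η in 𝓝 (0 : ℝ), (c η ᵥ* A) ⬝ᵥ c η < 0 :=
    (show Continuous fun η => (c η ᵥ* A) ⬝ᵥ c η by fun_prop).continuousAt.eventually_lt_const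
      (by simpa [c] using hTT)
  have h2 : ∀ᶠ η in 𝓝 (0 : ℝ), (T ᵥ* A) ⬝ᵥ c η < 0 :=
    (show Continuous fun η => (T ᵥ* A) ⬝ᵥ c η by fun_prop).continuousAt.eventually_lt_const
      (by simpa [c] using hTT)
  obtain ⟨δ, hδ, hball⟩ := Metric.eventually_nhds_iff_ball.1 (h1.and h2)
  have main : ∀ η ∈ Metric.ball (0 : ℝ) δ, T j + η ≠ T i₀ * r j →
      ∃ w : Model n, (w ᵥ* A) ⬝ᵥ w < 0 ∧ (T ᵥ* A) ⬝ᵥ w < 0 ∧ ∃ j, w j ≠ w i₀ * r j := by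
    intro η hη hne
    obtain ⟨a1, a2⟩ := hball η hη
    refine ⟨WithLp.toLp 2 (c η), a1, a2, j, ?_⟩
    simpa [c, hj.symm] using hne
  by_cases h : T j = T i₀ * r j
  · refine main (δ / 2) ?_ ?_
    · rw [Metric.mem_ball, Real.dist_eq, sub_zero, abs_of_pos (by linarith)]
      linarith
    · rw [h]; intro h'; linarith
  · exact main 0 (Metric.mem_ball_self hδ) (by simpa using h)

end CoordinateLines

/-! ### The fluid velocity near `O` and its integral curves. -/

section Fluid

variable {n : ℕ} {M N : Type*} [TopologicalSpace M] [ChartedSpace (Model n) M]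
  [IsManifold (𝓡 (n + 1)) ∞ M]
  [TopologicalSpace N] [ChartedSpace (Model n) N] [IsManifold (𝓡 (n + 1)) ∞ N]
  {S : Spacetime n ∞ M} {S' : Spacetime n 0 N} {ι : M → N}

/-- An isometry of nondegenerate forms is injective, and the dimensions agree. Hence every
coordinate vector of the extension at a point of `M` is available for testing tensor identities. -/
theorem IsContinuousExtension.mfderiv_surjective (hext : IsContinuousExtension S S' ι) (x : M) :
    Function.Surjective (mfderiv (𝓡 (n + 1)) (𝓡 (n + 1)) ι x) := by
  have hinj : Function.Injective (mfderiv (𝓡 (n + 1)) (𝓡 (n + 1)) ι x) := by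
    rw [injective_iff_map_eq_zero]
    intro v hv
    refine (S.isLorentzian x).eq_zero_of_forall fun w => ?_
    rw [← hext.isometric, hv, map_zero]
  let D : Model n →ₗ[ℝ] Model n := (mfderiv (𝓡 (n + 1)) (𝓡 (n + 1)) ι x).toLinearMap
  exact (LinearMap.injective_iff_surjective (f := D)).1 hinj

/-- The components, in coordinates `e` of the extension, of a vector field on `M`. -/
def pushforwardComp (ι : M → N) (e : OpenPartialHomeomorph N (Model n))
    (u : ∀ x : M, TangentSpace (𝓡 (n + 1)) x) (x : M) : Fin (n + 1) → ℝ :=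
  coordForm e (ι x) (mfderiv (𝓡 (n + 1)) (𝓡 (n + 1)) ι x (u x))

theorem pushforwardComp_unit (hext : IsContinuousExtension S S' ι)
    {u : ∀ x : M, TangentSpace (𝓡 (n + 1)) x} {e : OpenPartialHomeomorph N (Model n)}
    (he : e ∈ IsManifold.maximalAtlas (𝓡 (n + 1)) ∞ N) {x : M} (hx : ι x ∈ e.source)
    (hu : S.metric x (u x) (u x) = -1) :
    (pushforwardComp ι e u x ᵥ* metricComp S'.metric e (e (ι x))) ⬝ᵥ pushforwardComp ι e u x
      = -1 := by
  rw [pushforwardComp, ← metric_eq_dotProduct he S'.metric hx, hext.isometric, hu]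

/-- The Einstein equations in the coordinates of the extension. -/
theorem ricci_components_eq (hext : IsContinuousExtension S S' ι)
    {u : ∀ x : M, TangentSpace (𝓡 (n + 1)) x} {ρ p : M → ℝ}
    (ha : S.SolvesEinsteinPerfectFluid u ρ p) {e : OpenPartialHomeomorph N (Model n)}
    (he : e ∈ IsManifold.maximalAtlas (𝓡 (n + 1)) ∞ N) {x : M} (hx : ι x ∈ e.source)
    {F : Matrix (Fin (n + 1)) (Fin (n + 1)) ℝ}
    (hF : ∀ v w : TangentSpace (𝓡 (n + 1)) x, ricci S.metric x v w = ∑ i, ∑ j, F i j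
      * coordForm e (ι x) (mfderiv (𝓡 (n + 1)) (𝓡 (n + 1)) ι x v) i
      * coordForm e (ι x) (mfderiv (𝓡 (n + 1)) (𝓡 (n + 1)) ι x w) j) :
    F = (8 * Real.pi * p x + scalarCurvature S.metric x / 2) • metricComp S'.metric e (e (ι x))
      + (8 * Real.pi * (ρ x + p x)) •
        vecMulVec (pushforwardComp ι e u x ᵥ* metricComp S'.metric e (e (ι x)))
          (pushforwardComp ι e u x ᵥ* metricComp S'.metric e (e (ι x))) := by
  have hsurj : ∀ ξ : Fin (n + 1) → ℝ, ∃ v : TangentSpace (𝓡 (n + 1)) x,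
      coordForm e (ι x) (mfderiv (𝓡 (n + 1)) (𝓡 (n + 1)) ι x v) = ξ := fun ξ => by
    obtain ⟨v', hv'⟩ := exists_coordForm_eq he hx ξ
    obtain ⟨v, rfl⟩ := hext.mfderiv_surjective x v'
    exact ⟨v, hv'⟩
  ext i j
  obtain ⟨v, hv⟩ := hsurj (Pi.single i 1)
  obtain ⟨w, hw⟩ := hsurj (Pi.single j 1)
  have h := ha.einstein x v w
  have hR : ricci S.metric x v w = F i j := by
    rw [hF, hv, hw]
    simp [Pi.single_apply]
  rw [hR, ← hext.isometric x v w, ← hext.isometric x (u x) v, ← hext.isometric x (u x) w,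
    metric_eq_dotProduct he S'.metric hx, metric_eq_dotProduct he S'.metric hx,
    metric_eq_dotProduct he S'.metric hx, hv, hw] at h
  simp only [dotProduct_single, single_vecMul, one_smul, mul_one] at h
  simp only [Matrix.add_apply, Matrix.smul_apply, vecMulVec_apply, smul_eq_mul, pushforwardComp]
  simp only [row_apply] at h
  linear_combination h

/-- If `ρ + p` does not vanish at `O`, the direction of the fluid velocity converges at `O`. -/
theorem exists_tendsto_fluid_direction (hext : IsContinuousExtension S S' ι) {O : N}
    (hO : O ∈ closure (range ι)) {u : ∀ x : M, TangentSpace (𝓡 (n + 1)) x} {ρ p : M → ℝ}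
    (ha : S.SolvesEinsteinPerfectFluid u ρ p) {ρ' p' : N → ℝ}
    (hρ : IsContinuousExtensionOf ι O ρ ρ') (hp : IsContinuousExtensionOf ι O p p')
    (hne : ρ' O + p' O ≠ 0) {e : OpenPartialHomeomorph N (Model n)}
    (he : e ∈ IsManifold.maximalAtlas (𝓡 (n + 1)) ∞ N) (hOe : O ∈ e.source)
    {F : Fin (n + 1) → Fin (n + 1) → N → ℝ}
    (hFc : ∀ i j, ContinuousOn (F i j) ((e.source ∩ range ι) ∪ {O}))
    (hF : ∀ x : M, ι x ∈ e.source → ∀ v w : TangentSpace (𝓡 (n + 1)) x,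
      ricci S.metric x v w = ∑ i, ∑ j, F i j (ι x)
        * coordForm e (ι x) (mfderiv (𝓡 (n + 1)) (𝓡 (n + 1)) ι x v) i
        * coordForm e (ι x) (mfderiv (𝓡 (n + 1)) (𝓡 (n + 1)) ι x w) j) :
    ∃ (i₀ : Fin (n + 1)) (r : Fin (n + 1) → ℝ),
      (∀ᶠ x in comap ι (𝓝 O), pushforwardComp ι e u x i₀ ≠ 0) ∧
      ∀ j, Tendsto (fun x => pushforwardComp ι e u x j / pushforwardComp ι e u x i₀)
        (comap ι (𝓝 O)) (𝓝 (r j)) := by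
  -- All limits at `O` are taken along `comap ι (𝓝 O)`, that is, through points of `M`; it is
  -- nontrivial because `O` lies in the closure of `M`.
  have hl : (comap ι (𝓝 O)).NeBot := by
    rw [comap_neBot_iff]
    intro t ht
    obtain ⟨_, h, x, rfl⟩ := mem_closure_iff_nhds.1 hO t ht
    exact ⟨x, h⟩
  have hι : Tendsto ι (comap ι (𝓝 O)) (𝓝 O) := tendsto_comap
  have hsrc : ∀ᶠ x in comap ι (𝓝 O), ι x ∈ e.source :=
    hι.eventually (e.open_source.mem_nhds hOe)
  have hFt : Tendsto (fun x => (Matrix.of fun i j => F i j (ι x))) (comap ι (𝓝 O))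
      (𝓝 (Matrix.of fun i j => F i j O)) := by
    refine tendsto_pi_nhds.2 fun i => tendsto_pi_nhds.2 fun j => ?_
    refine Tendsto.comp (hFc i j O (by simp)) (tendsto_nhdsWithin_iff.2 ⟨hι, ?_⟩)
    filter_upwards [hsrc] with x hx using Or.inl ⟨hx, mem_range_self x⟩
  have hext' : ∀ {f : M → ℝ} {f' : N → ℝ}, IsContinuousExtensionOf ι O f f' →
      Tendsto f (comap ι (𝓝 O)) (𝓝 (f' O)) := fun {f f'} hf => by
    have := Tendsto.comp (hf.1 O (by simp)) (tendsto_nhdsWithin_iff.2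
      ⟨hι, Eventually.of_forall fun x => Or.inl (mem_range_self x)⟩)
    exact this.congr hf.2
  have hμt : Tendsto (fun x => 8 * Real.pi * (ρ x + p x)) (comap ι (𝓝 O))
      (𝓝 (8 * Real.pi * (ρ' O + p' O))) := ((hext' hρ).add (hext' hp)).const_mul _
  have hμ0 : 8 * Real.pi * (ρ' O + p' O) ≠ 0 :=
    mul_ne_zero (by have := Real.pi_pos; positivity) hne
  have hAt : Tendsto (fun x => metricComp S'.metric e (e (ι x))) (comap ι (𝓝 O))
      (𝓝 (metricComp S'.metric e (e O))) :=
    (continuousAt_metricComp S' he (e.map_source hOe)).tendsto.comp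
      ((e.continuousAt hOe).tendsto.comp hι)
  have hdet := isUnit_det_metricComp S' he hOe
  have hBt : Tendsto (fun x => (metricComp S'.metric e (e (ι x)))⁻¹) (comap ι (𝓝 O))
      (𝓝 (metricComp S'.metric e (e O))⁻¹) := by
    have h1 : ContinuousAt (fun A : Matrix (Fin (n + 1)) (Fin (n + 1)) ℝ => A⁻¹)
        (metricComp S'.metric e (e O)) := by
      apply continuousAt_matrix_inv
      rw [Ring.inverse_eq_inv']
      exact continuousAt_inv₀ hdet.ne_zero
    exact h1.tendsto.comp hAt
  -- The limit is that of the formula in `vecMulVec_eq_of_perfectFluid`, which is free of the scalar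
  -- curvature.
  obtain ⟨W, hW⟩ : ∃ W : Matrix (Fin (n + 1)) (Fin (n + 1)) ℝ,
      Tendsto (fun x => vecMulVec (pushforwardComp ι e u x) (pushforwardComp ι e u x))
        (comap ι (𝓝 O)) (𝓝 W) := by
    have htr : Continuous fun B : Matrix (Fin (n + 1)) (Fin (n + 1)) ℝ => B.trace :=
      continuous_id.matrix_trace
    have htp : Continuous fun B : Matrix (Fin (n + 1)) (Fin (n + 1)) ℝ => Bᵀ :=
      continuous_id.matrix_transpose
    have hBT := (htp.tendsto _).comp hBt
    refine ⟨_, Tendsto.congr' ?_ ((hμt.inv₀ hμ0).smul (((hBT.mul hFt).mul hBt).sub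
      (((((htr.tendsto _).comp (hBt.mul hFt)).add hμt).div_const
        (Fintype.card (Fin (n + 1)) : ℝ)).smul hBT)))⟩
    filter_upwards [hsrc, hμt.eventually_ne hμ0] with x hx hμx
    exact (vecMulVec_eq_of_perfectFluid (isUnit_det_metricComp S' he hx) hμx
      (pushforwardComp_unit hext he hx (ha.unit x))
      (ricci_components_eq hext ha he hx (hF x hx))).symm
  have hWij : ∀ i j, Tendsto (fun x => pushforwardComp ι e u x i * pushforwardComp ι e u x j)
      (comap ι (𝓝 O)) (𝓝 (W i j)) := fun i j =>
    tendsto_pi_nhds.1 (tendsto_pi_nhds.1 hW i) j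
  -- If all `u_i u_j` tended to zero, so would `g(u, u) = -1`, the metric components being
  -- convergent.
  have hWne : ∃ i j, W i j ≠ 0 := by
    by_contra! h0
    have h1 : Tendsto (fun x => ∑ j, ∑ i, metricComp S'.metric e (e (ι x)) i j *
        (pushforwardComp ι e u x i * pushforwardComp ι e u x j)) (comap ι (𝓝 O))
        (𝓝 (∑ j, ∑ i, metricComp S'.metric e (e O) i j * W i j)) :=
      tendsto_finsetSum _ fun j _ => tendsto_finsetSum _ fun i _ =>
        (tendsto_pi_nhds.1 (tendsto_pi_nhds.1 hAt i) j).mul (hWij i j)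
    have h2 : Tendsto (fun _ : M => (-1 : ℝ)) (comap ι (𝓝 O))
        (𝓝 (∑ j, ∑ i, metricComp S'.metric e (e O) i j * W i j)) := by
      refine h1.congr' ?_
      filter_upwards [hsrc] with x hx
      rw [← pushforwardComp_unit hext he hx (ha.unit x)]
      simp only [dotProduct, vecMul, Finset.sum_mul]
      exact Finset.sum_congr rfl fun j _ => Finset.sum_congr rfl fun i _ => by ring
    have h3 := tendsto_nhds_unique h2 tendsto_const_nhds
    simp [h0] at h3
  obtain ⟨i₀, h1, h2⟩ := exists_tendsto_ratio hWij hl hWne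
  exact ⟨i₀, _, h1, h2⟩

theorem hasDerivAt_coord_integralCurve (hext : IsContinuousExtension S S' ι)
    {u : ∀ x : M, TangentSpace (𝓡 (n + 1)) x} {e : OpenPartialHomeomorph N (Model n)}
    (he : e ∈ IsManifold.maximalAtlas (𝓡 (n + 1)) ∞ N) {d : ℝ → M} {t : ℝ}
    (ht : ι (d t) ∈ e.source) (hd : IsMIntegralCurveAt d u t) (j : Fin (n + 1)) :
    HasDerivAt (fun s => e (ι (d s)) j) (pushforwardComp ι e u (d t) j) t := by
  have h1 : HasMFDerivAt (𝓡 (n + 1)) (𝓡 (n + 1)) ι (d t)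
      (mfderiv (𝓡 (n + 1)) (𝓡 (n + 1)) ι (d t)) :=
    ((hext.isSmoothEmbedding.contMDiff (d t)).mdifferentiableAt (by simp)).hasMFDerivAt
  have h2 := ((mdifferentiable_of_mem_maximalAtlas_infty he).mdifferentiableAt ht).hasMFDerivAt
  have h3 := HasMFDerivAt.comp t h2 (HasMFDerivAt.comp t h1 hd.hasMFDerivAt)
  let D : ℝ →L[ℝ] Model n := (mfderiv (𝓡 (n + 1)) (𝓡 (n + 1)) e (ι (d t))).comp
    ((mfderiv (𝓡 (n + 1)) (𝓡 (n + 1)) ι (d t)).comp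
      ((1 : ℝ →L[ℝ] ℝ).smulRight (u (d t))))
  have h4 : HasFDerivAt (fun s => e (ι (d s))) D t := h3.hasFDerivAt
  have hD : D 1 j = pushforwardComp ι e u (d t) j :=
    congrArg (fun z => (show Model n from mfderiv (𝓡 (n + 1)) (𝓡 (n + 1)) e (ι (d t))
      (mfderiv (𝓡 (n + 1)) (𝓡 (n + 1)) ι (d t) z)) j) (one_smul ℝ (u (d t)))
  rw [← hD]
  exact (EuclideanSpace.proj (𝕜 := ℝ) j).hasFDerivAt.comp_hasDerivAt t h4.hasDerivAt

/-- Every point of `M` is joined to `O` by an integral curve of the fluid velocity. -/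
theorem exists_integralCurve_to {u : ∀ x : M, TangentSpace (𝓡 (n + 1)) x} {ρ p : M → ℝ}
    (ha : S.SolvesEinsteinPerfectFluid u ρ p) {O : N}
    (hb : IntegralCurvesHavePastEndpoint S' ι u O) (x : M) :
    ∃ (d : ℝ → M) (a b : ℝ) (γ : ℝ → N), d b = x ∧ IsMIntegralCurveOn d u (Ioc a b) ∧ γ a = O ∧
      (∀ t ∈ Ioc a b, γ t = ι (d t)) ∧ S'.IsTimelikeCurve γ a b := by
  obtain ⟨c, hc0, hc⟩ := exists_isMIntegralCurveAt_of_contMDiffAt_boundaryless (t₀ := 0)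
    ((ha.contMDiff_u x).of_le (by simp : (1 : WithTop ℕ∞) ≤ ∞))
  obtain ⟨ε, hε, hcε⟩ := isMIntegralCurveAt_iff'.1 hc
  -- The interval is closed at `0`, so that the continued curve still ends at `x`.
  have hsub : Ioc (-(ε / 2)) 0 ⊆ Metric.ball (0 : ℝ) ε := fun t ht => by
    rw [Metric.mem_ball, Real.dist_eq, sub_zero, abs_lt]
    exact ⟨by linarith [ht.1], by linarith [ht.2]⟩
  obtain ⟨d, a, -, hdc, hd, γ, h1, h2, h3⟩ := hb c (-(ε / 2)) 0 (by linarith) (hcε.mono hsub)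
  refine ⟨d, a, 0, γ, ?_, hd, h1, h2, h3⟩
  rw [hdc ⟨by linarith, le_rfl⟩, hc0]

/-- A point of `M` with an integral curve from `O` that stays in a region of almost constant fluid
direction lies, seen from `O`, in almost that direction. -/
theorem exists_ratio_of_integralCurve (hext : IsContinuousExtension S S' ι)
    {u : ∀ x : M, TangentSpace (𝓡 (n + 1)) x} {e : OpenPartialHomeomorph N (Model n)}
    (he : e ∈ IsManifold.maximalAtlas (𝓡 (n + 1)) ∞ N) {d : ℝ → M} {γ : ℝ → N} {a b : ℝ}
    (hab : a < b) (hγ : ContinuousOn γ (Icc a b)) (hγe : ∀ t ∈ Icc a b, γ t ∈ e.source)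
    (hd : IsMIntegralCurveOn d u (Ioc a b)) (hγd : ∀ t ∈ Ioc a b, γ t = ι (d t))
    (i j : Fin (n + 1)) :
    ∃ t ∈ Ioo a b, (e (γ b) j - e (γ a) j) * pushforwardComp ι e u (d t) i
      = (e (γ b) i - e (γ a) i) * pushforwardComp ι e u (d t) j := by
  have hcont : ∀ j, ContinuousOn (fun t => e (γ t) j) (Icc a b) := fun j =>
    (EuclideanSpace.proj (𝕜 := ℝ) j).continuous.comp_continuousOn
      (e.continuousOn.comp hγ hγe)
  have hder : ∀ j, ∀ t ∈ Ioo a b,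
      HasDerivAt (fun t => e (γ t) j) (pushforwardComp ι e u (d t) j) t := fun j t ht => by
    have htd : ι (d t) ∈ e.source := by
      rw [← hγd t ⟨ht.1, ht.2.le⟩]; exact hγe t ⟨ht.1.le, ht.2.le⟩
    refine (hasDerivAt_coord_integralCurve hext he htd
      (hd.isMIntegralCurveAt (Ioc_mem_nhds ht.1 ht.2)) j).congr_of_eventuallyEq ?_
    filter_upwards [Ioc_mem_nhds ht.1 ht.2] with s hs
    rw [hγd s hs]
  -- Cauchy's mean value theorem treats two components at the same parameter, and needs only
  -- continuity at the endpoint `O`, where `u` is undefined.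
  obtain ⟨t, ht, h⟩ := exists_ratio_hasDerivAt_eq_ratio_slope (fun t => e (γ t) i) _ hab
    (hcont i) (hder i) (fun t => e (γ t) j) _ (hcont j) (hder j)
  exact ⟨t, ht, h⟩

end Fluid

end Spacetimes

end

/-! ### The contradiction at `O`. -/

theorem theorem2p2 (n : ℕ) (hn : 1 ≤ n)
    {M : Type*} [TopologicalSpace M] [T2Space M] [SecondCountableTopology M]
    [ChartedSpace (EuclideanSpace ℝ (Fin (n + 1))) M] [IsManifold (𝓡 (n + 1)) ∞ M]
    {Mext : Type*} [TopologicalSpace Mext] [T2Space Mext] [SecondCountableTopology Mext]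
    [ChartedSpace (EuclideanSpace ℝ (Fin (n + 1))) Mext] [IsManifold (𝓡 (n + 1)) ∞ Mext]
    (S : Spacetimes.Spacetime n ∞ M) (Sext : Spacetimes.Spacetime n 0 Mext)
    (ι : M → Mext) (hext : Spacetimes.IsContinuousExtension S Sext ι)
    (O : Mext) (hO : O ∈ Sext.pastBoundary (range ι))
    (hM : range ι = Sext.timelikeFuture O)
    (u : ∀ x : M, TangentSpace (𝓡 (n + 1)) x) (ρ p : M → ℝ)
    (ha : S.SolvesEinsteinPerfectFluid u ρ p)
    (hb : Spacetimes.IntegralCurvesHavePastEndpoint Sext ι u O)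
    (hRic : Spacetimes.TensorExtendsContinuously ι O (Spacetimes.ricci S.metric))
    (ρ' p' : Mext → ℝ)
    (hρ : Spacetimes.IsContinuousExtensionOf ι O ρ ρ')
    (hp : Spacetimes.IsContinuousExtensionOf ι O p p')
    (hd : Sext.IsStronglyCausalAt O) :
    ρ' O = -p' O := by
  by_contra hne
  obtain ⟨e, he, hOe, F, hFc, hF⟩ := hRic
  obtain ⟨i₀, r, hi₀, hr⟩ := Spacetimes.exists_tendsto_fluid_direction hext hO.1.1 ha hρ hp
    (fun h => hne (eq_neg_of_add_eq_zero_left h)) he hOe hFc hF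
  obtain ⟨w, hw, hTw, j, hj⟩ := Spacetimes.exists_timelike_direction hn Sext he hOe i₀ r
  -- Near `O`, the fluid direction is too close to `r` to reach the points in direction `w`.
  have hgood : ∀ᶠ x in Filter.comap ι (𝓝 O), Spacetimes.pushforwardComp ι e u x i₀ ≠ 0 ∧
      w j ≠ w i₀ * (Spacetimes.pushforwardComp ι e u x j /
        Spacetimes.pushforwardComp ι e u x i₀) :=
    hi₀.and (((hr j).const_mul (w i₀)).eventually_ne hj.symm |>.mono fun x hx => hx.symm)
  obtain ⟨U, hU, hUgood⟩ := Filter.mem_comap.1 hgood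
  -- Intersecting with the chart domain keeps the whole fluid line inside one coordinate system.
  obtain ⟨V, hV, -, hVU⟩ := hd (U ∩ e.source)
    (Filter.inter_mem hU (e.open_source.mem_nhds hOe))
  have hl0 : Spacetimes.coordLine e (e O) w 0 = O := by
    simp [Spacetimes.coordLine, e.left_inv hOe]
  have hline : ContinuousAt (Spacetimes.coordLine e (e O) w) 0 :=
    (Spacetimes.contMDiffAt_coordLine he (by simpa using e.map_source hOe)).continuousAt
  have hVs : ∀ᶠ s in 𝓝 (0 : ℝ), Spacetimes.coordLine e (e O) w s ∈ V ∧
      e O + s • w ∈ e.target := by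
    refine (hline.eventually (by rwa [hl0])).and ?_
    have hc : ContinuousAt (fun s : ℝ => e O + s • w) 0 := by fun_prop
    exact hc.eventually (by simpa using e.open_target.eventually_mem (e.map_source hOe))
  obtain ⟨s, ⟨hst, hsV, hse⟩, hs0 : 0 < s⟩ :=
    (((Spacetimes.eventually_isTimelikeCurve_coordLine Sext he hOe hw hTw).and
      (hVs.filter_mono nhdsWithin_le_nhds)).and self_mem_nhdsWithin).exists
  obtain ⟨x, hx⟩ : Spacetimes.coordLine e (e O) w s ∈ range ι := by
    rw [hM]; exact ⟨_, 0, s, hst, hl0, rfl⟩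
  obtain ⟨d, a, b, γ, hdb, hdI, hγa, hγd, hγt⟩ := Spacetimes.exists_integralCurve_to ha hb x
  have hab : a < b := hγt.1.1
  have hγb : γ b = Spacetimes.coordLine e (e O) w s := by
    rw [hγd b ⟨hab, le_rfl⟩, hdb, hx]
  have hγU := hVU γ a b hγt.1 (by rw [hγa]; exact mem_of_mem_nhds hV) (by rwa [hγb])
  obtain ⟨t, ht, h⟩ := Spacetimes.exists_ratio_of_integralCurve hext he hab hγt.1.2.1.1
    (fun t ht => (hγU t ht).2) hdI hγd i₀ j
  have htU : ι (d t) ∈ U := by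
    rw [← hγd t ⟨ht.1, ht.2.le⟩]; exact (hγU t ⟨ht.1.le, ht.2.le⟩).1
  obtain ⟨hne0, hnej⟩ := hUgood htU
  have heb : e (γ b) = e O + s • w := by
    rw [hγb]; exact e.right_inv hse
  rw [heb, hγa] at h
  simp only [PiLp.add_apply, PiLp.smul_apply, smul_eq_mul, add_sub_cancel_left] at h
  -- The mean value identity is now `s w_j u_{i₀} = s w_{i₀} u_j` at `d t`; cancelling `s > 0` and
  -- dividing by `u_{i₀} ≠ 0` gives the proportion excluded on `U`.
  apply hnej
  field_simp
  apply mul_left_cancel₀ hs0.ne'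
  linear_combination h
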